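/- Conventions. All graphs are finite. For a positive integer $k$, a connected graph of order at least $2k+2$ is $k$-extendable if it has a matching of cardinality $k$ and every matching of cardinality $k$ is contained in a perfect matching. A $k$-extendable graph $G$ is minimal if $G-e$ is not $k$-extendable for every edge $e$ of $G$. A leaf of a tree is a vertex of degree one. A tree is an $r$-tree if each of its non-leaves has degree at least $r$, and a regular $r$-tree if each of its non-leaves has degree exactly $r$. A star is a graph $K_{1,p}$ with $p\ge 2$. Let $T$ be a tree with at least two vertices and let $L$ be its set of leaves. Let $H$ be the graph obtained from the disjoint union of $k$ copies of $T$ by identifying, for each $\ell\in L$, the $k$ copies of $\ell$ into a single vertex (so $L$ is regarded as a subset of $V(H)$). Let $H'$ be a disjoint copy of $H$ and fix an isomorphism $\varphi\colon H\to H'$. A graph (isomorphic to one) obtained from $H\cup H'$ by adding the edges $\ell\,\varphi(\ell)$, $\ell\in L$, is said to be obtained from $T$ by isomorphic $k$-leaf matching. Statement. Let $k$ be a positive integer, and let $T$ be a $(k+1)$-tree that is neither $K_2$ nor a star $K_{1,p}$ with $p<2k$. Let $G$ be a graph obtained from $T$ by isomorphic $k$-leaf matching, let $n=|V(G)|$ and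 $m=|E(G)|$, and let $V_{k+1}$ be the set of vertices of $G$ of degree exactly $k+1$. Then $G$ is bipartite and is a minimal $k$-extendable graph. If moreover $T$ is a $(k+2)$-tree, then $$|V_{k+1}|=\frac{2(m-n+2k)}{2k-1};$$ furthermore, (i) if $T$ is a regular $(k+2)$-tree, then $|V_{k+1}|=\frac n2+2$; (ii) if $T$ is a star, then $|E(G)|=\frac{(2k+1)(n-2k)}{2}$. -/

import Mathlib

namespace KLeafMatching

open SimpleGraph

/-- A connected graph of order at least `2k + 2` is `k`-extendable (`k ≥ 1`) if it has a matching
with exactly `k` edges, and every such matching is contained in a perfect matching. -/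
structure IsExtendable {W : Type*} (G : SimpleGraph W) (k : ℕ) : Prop where
  connected : G.Connected
  order : 2 * k + 2 ≤ Nat.card W
  exists_matching : ∃ M : G.Subgraph, M.IsMatching ∧ M.edgeSet.ncard = k
  extends_to_perfect : ∀ M : G.Subgraph, M.IsMatching → M.edgeSet.ncard = k →
    ∃ P : G.Subgraph, P.IsPerfectMatching ∧ M ≤ P

/-- A bipartite `k`-extendable graph is minimal if deleting any single edge
destroys `k`-extendability. -/
structure IsMinimalBipartiteExtendable {W : Type*} (G : SimpleGraph W) (k : ℕ) : Prop where
  bipartite : G.IsBipartite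
  extendable : IsExtendable G k
  minimal : ∀ e ∈ G.edgeSet, ¬ IsExtendable (G.deleteEdges {e}) k

section Tree

variable {V : Type*} (T : SimpleGraph V) [T.LocallyFinite]

/-- An `r`-tree: a tree all of whose non-leaves have degree at least `r`. -/
def IsRTree (r : ℕ) : Prop :=
  T.IsTree ∧ ∀ v, T.degree v ≠ 1 → r ≤ T.degree v

/-- A regular `r`-tree: a tree all of whose non-leaves have degree exactly `r`. -/
def IsRegularRTree (r : ℕ) : Prop :=
  T.IsTree ∧ ∀ v, T.degree v ≠ 1 → T.degree v = r

/-- `T` is the star `K_{1,p}`; stars have `p ≥ 2`. -/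
def IsStar (p : ℕ) : Prop :=
  2 ≤ p ∧ Nonempty (T ≃g completeBipartiteGraph (Fin 1) (Fin p))

/-- The vertices of the graph made from `k` copies of `T` by identifying the `k` copies of each
leaf: one vertex for each leaf of `T`, and `k` vertices for each non-leaf. -/
abbrev GluedVertex (k : ℕ) : Type _ :=
  {v : V // T.degree v = 1} ⊕ (Fin k × {v : V // T.degree v ≠ 1})

/-- The vertex of the glued graph that represents the vertex `v` of the `i`-th copy of `T`. -/
def copyVertex (k : ℕ) (i : Fin k) (v : V) : GluedVertex T k :=
  if h : T.degree v = 1 then Sum.inl ⟨v, h⟩ else Sum.inr (i, ⟨v, h⟩)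

theorem copyVertex_injective (k : ℕ) (i : Fin k) : Function.Injective (copyVertex T k i) := by
  intro u v h
  unfold copyVertex at h
  split_ifs at h <;> simpa using h

/-- The graph `H` made from `k` copies of `T` by identifying, for each leaf of `T`,
all of its `k` copies into a single vertex. -/
def gluedGraph (k : ℕ) : SimpleGraph (GluedVertex T k) where
  Adj x y := ∃ (i : Fin k) (u v : V), T.Adj u v ∧ copyVertex T k i u = x ∧ copyVertex T k i v = y
  symm := ⟨by
    rintro x y ⟨i, u, v, h, hu, hv⟩
    exact ⟨i, v, u, h.symm, hv, hu⟩⟩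
  loopless := ⟨by
    rintro x ⟨i, u, v, h, hu, hv⟩
    exact h.ne (copyVertex_injective T k i (hu.trans hv.symm))⟩

/-- The vertices of the glued graph that come from the leaves of `T`. -/
def gluedLeaves (k : ℕ) : Set (GluedVertex T k) := Set.range Sum.inl

end Tree

/-- The disjoint union of `H` and `H'` together with the matching that joins each vertex `a ∈ L`
of `H` to the corresponding vertex `φ a` of `H'`. -/
def joinAlong {α β : Type*} (H : SimpleGraph α) (L : Set α) (H' : SimpleGraph β) (φ : H ≃g H') :
    SimpleGraph (α ⊕ β) :=
  (H ⊕g H') ⊔ SimpleGraph.fromEdgeSet ((fun a => s(Sum.inl a, Sum.inr (φ a))) '' L)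

/-- `G` is (up to isomorphism) obtained from `T` by isomorphic `k`-leaf matching: `H'` is a copy
of the glued graph `H`, and each leaf vertex of `H` is joined to its image in `H'` under a fixed
isomorphism from `H` to `H'`. -/
def IsIsomorphicLeafMatching {V W : Type*} (T : SimpleGraph V) [T.LocallyFinite] (k : ℕ)
    (G : SimpleGraph W) : Prop :=
  ∃ (H' : SimpleGraph (GluedVertex T k)) (φ : gluedGraph T k ≃g H'),
    Nonempty (G ≃g joinAlong (gluedGraph T k) (gluedLeaves T k) H' φ)

end KLeafMatching

namespace KLeafMatching

open SimpleGraph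

/-! Let X be the vertex set of the glued graph H, with a loop added at each leaf. A tree is
2-colourable, hence so is H, and the colouring identifies G with the bipartite double cover of
looped H; the edges ℓφ(ℓ) are the lifts of the loops (`nonempty_joinAlong_iso_leafCover`).

By Hall's theorem, matchings of size k extend if |A| + |B| + k ≤ |X| for all nonempty unrelated A,
B, that is, |A ∩ B| + k ≤ |(A ∪ B)ᶜ|. Loops keep leaves out of A ∩ B. Copy i of T contributes q_i
common vertices and o_i non-leaves missed by both sets, while the c missed leaves are shared by all
copies; so Σ q_i + k ≤ c + Σ o_i is needed (`card_add_card_add_le`). Counting edges in forests gives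
k q_i + 1 ≤ o_i + c when q_i > 0. If c ≥ k, each copy may spend c/k of the leaves and the bounds are
added; small stars fail here. If c < k, a copy with q_i > 0 has surplus k by itself; if every q_i is
0, the surplus comes from a free non-leaf in every copy, or from the many neighbours of a set
without leaves.

For minimality, when an edge at a leaf is deleted, some k matching edges cover all remaining
neighbours of that leaf. For an edge uv between non-leaves, matching all k copies of v to those of u
forces k crossings in the other direction, and only k - 1 survive the deletion.

The counts are the handshake lemma in T and in G. -/

/-- Two injective families of vertices with disjoint ranges and adjacent corresponding members
form a matching. -/
theorem exists_isMatching_of_injective {W ι : Type*} (G : SimpleGraph W) (f g : ι → W)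
    (hf : Function.Injective f) (hg : Function.Injective g) (hfg : ∀ i j, f i ≠ g j)
    (hadj : ∀ i, G.Adj (f i) (g i)) :
    ∃ M : G.Subgraph, M.IsMatching ∧ M.edgeSet.ncard = Nat.card ι ∧ (∀ i, M.Adj (f i) (g i)) ∧
      M.verts = Set.range f ∪ Set.range g := by
  refine ⟨⨆ i, G.subgraphOfAdj (hadj i), ?_, ?_, ?_, ?_⟩
  · refine Subgraph.IsMatching.iSup (fun i => Subgraph.IsMatching.subgraphOfAdj _) ?_
    intro i j hij
    change Disjoint (G.subgraphOfAdj (hadj i)).support (G.subgraphOfAdj (hadj j)).support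
    rw [(Subgraph.IsMatching.subgraphOfAdj _).support_eq_verts,
      (Subgraph.IsMatching.subgraphOfAdj _).support_eq_verts]
    have h1 := hf.ne hij
    have h2 := hg.ne hij
    have h3 := hfg i j
    have h4 := hfg j i
    simp [subgraphOfAdj, Set.disjoint_left]
    grind
  · have hset : (⨆ i, G.subgraphOfAdj (hadj i)).edgeSet = Set.range fun i => s(f i, g i) := by
      ext e
      simp [Subgraph.edgeSet_iSup, eq_comm]
    have hinj : Function.Injective fun i => s(f i, g i) := by
      intro i j hij
      rcases Sym2.eq_iff.1 hij with h | h
      · exact hf h.1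
      · exact absurd h.1 (hfg i j)
    rw [hset, ← Set.image_univ, Set.ncard_image_of_injective _ hinj, Set.ncard_univ]
  · intro i
    simp only [Subgraph.iSup_adj]
    exact ⟨i, by simp [subgraphOfAdj]⟩
  · ext x
    simp only [Subgraph.verts_iSup, Set.mem_iUnion, subgraphOfAdj_verts, Set.mem_insert_iff,
      Set.mem_singleton_iff, Set.mem_union, Set.mem_range]
    grind

/-! ### Matchings in bipartite double covers -/

/-- The bipartite double cover of a symmetric relation, which may have loops. -/
def doubleCover {X : Type*} (R : X → X → Prop) (hR : ∀ x y, R x y → R y x) :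
    SimpleGraph (X × Bool) where
  Adj p q := p.2 ≠ q.2 ∧ R p.1 q.1
  symm := ⟨fun _ _ h => ⟨h.1.symm, hR _ _ h.2⟩⟩
  loopless := ⟨fun _ h => h.1 rfl⟩

section DoubleCover

variable {X : Type*} {R : X → X → Prop} {hR : ∀ x y, R x y → R y x}

theorem doubleCover_isBipartite : (doubleCover R hR).IsBipartite :=
  ⟨Coloring.mk (fun p => if p.2 then 0 else 1) (by
    rintro ⟨x, b⟩ ⟨y, c⟩ ⟨h, -⟩
    cases b <;> cases c <;> simp_all)⟩

/-- Every matching edge has exactly one end in each colour class. -/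
theorem ncard_edgeSet_eq_ncard_colour (M : (doubleCover R hR).Subgraph) (hM : M.IsMatching)
    (b : Bool) : M.edgeSet.ncard = {x | (x, b) ∈ M.verts}.ncard := by
  symm
  have hp : ∀ x, ∀ h : (x, b) ∈ M.verts, ∃ y, M.Adj (x, b) y := fun x h => (hM h).exists
  choose p hp using hp
  refine Set.ncard_congr (fun x hx => s((x, b), p x hx)) ?_ ?_ ?_
  · intro x hx
    exact hp x hx
  · intro x y hx hy h
    have h1 := (M.adj_sub (hp x hx)).1
    have h2 := (M.adj_sub (hp y hy)).1
    rcases Sym2.eq_iff.1 h with h | h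
    · exact congrArg Prod.fst h.1
    · rw [h.2] at h1
      exact absurd rfl h1
  · intro e
    induction e with
    | _ u v =>
      intro h
      have huv : M.Adj u v := h
      have hne := (M.adj_sub huv).1
      obtain ⟨x, c⟩ := u
      obtain ⟨y, d⟩ := v
      by_cases hc : c = b
      · subst hc
        refine ⟨x, M.edge_vert huv, ?_⟩
        rw [hM.eq_of_adj_left (hp x (M.edge_vert huv)) huv]
      · have hd : d = b := by cases b <;> cases c <;> cases d <;> simp_all
        subst hd
        refine ⟨y, M.edge_vert huv.symm, ?_⟩
        rw [hM.eq_of_adj_left (hp y (M.edge_vert huv.symm)) huv.symm, Sym2.eq_swap]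

variable [Fintype X]

/-- If independent sets meeting both colour classes leave out at least `k` vertices more than half
of the graph, then every matching with `k` edges extends to a perfect matching. -/
theorem exists_isPerfectMatching_of_independent_bound (k : ℕ)
    (h : ∀ A B : Finset X, A.Nonempty → B.Nonempty → (∀ x ∈ A, ∀ y ∈ B, ¬ R x y) →
      A.card + B.card + k ≤ Fintype.card X)
    (M : (doubleCover R hR).Subgraph) (hM : M.IsMatching) (hk : M.edgeSet.ncard = k) :
    ∃ P : (doubleCover R hR).Subgraph, P.IsPerfectMatching ∧ M ≤ P := by
  classical
  let E : Bool → Finset X := fun b => Finset.univ.filter fun x => (x, b) ∈ M.verts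
  have hE : ∀ b, (E b).card = k := by
    intro b
    rw [← hk, ncard_edgeSet_eq_ncard_colour M hM b, ← Set.ncard_coe_finset]
    simp [E]
  have hmem : ∀ x b, x ∈ E b ↔ (x, b) ∈ M.verts := by simp [E]
  let t : {x // x ∉ E true} → Finset X :=
    fun x => (Finset.univ.filter fun y => R x.1 y) \ E false
  -- Hall's condition for what `M` leaves uncovered. The hypothesis applies to `S'` and its
  -- non-neighbours; if there are none, `S'` misses the `k` covered vertices of its own colour,
  -- which balances the loss of `E false`.
  have hall : ∀ S : Finset {x // x ∉ E true}, S.card ≤ (S.biUnion t).card := by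
    intro S
    rcases S.eq_empty_or_nonempty with rfl | hS
    · simp
    let S' : Finset X := S.map (Function.Embedding.subtype _)
    have hS'c : S'.card = S.card := Finset.card_map _
    let N : Finset X := Finset.univ.filter fun y => ∃ x ∈ S', R x y
    have hN : S.biUnion t = N \ E false := by
      ext y
      simp only [Finset.mem_biUnion, t, N, S', Finset.mem_sdiff, Finset.mem_filter,
        Finset.mem_univ, true_and, Finset.mem_map, Function.Embedding.subtype_apply]
      grind
    have hle : N.card ≤ (N \ E false).card + k := by
      have := Finset.le_card_sdiff (E false) N
      have := hE false
      omega
    rw [hN]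
    by_cases hc : Nᶜ.Nonempty
    · have h1 := h S' Nᶜ (by simpa [S'] using hS) hc (by
        intro x hx y hy hxy
        simp only [N, Finset.mem_compl, Finset.mem_filter, Finset.mem_univ, true_and] at hy
        exact hy ⟨x, hx, hxy⟩)
      have := Finset.card_add_card_compl N
      omega
    · rw [Finset.not_nonempty_iff_eq_empty] at hc
      have h2 : N.card = Fintype.card X := by
        have := Finset.card_add_card_compl N
        simp_all
      have h3 : S'.card + (E true).card ≤ Fintype.card X := by
        rw [← Finset.card_union_of_disjoint]
        · exact Finset.card_le_univ _
        · rw [Finset.disjoint_left]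
          intro x hx
          simp only [S', Finset.mem_map, Function.Embedding.subtype_apply] at hx
          obtain ⟨a, -, rfl⟩ := hx
          exact a.2
      have := hE true
      omega
  obtain ⟨f, hf, hft⟩ := (Finset.all_card_le_biUnion_card_iff_exists_injective t).1 hall
  have hf' : ∀ x, R x.1 (f x) ∧ f x ∉ E false := by
    intro x
    simpa [t] using hft x
  obtain ⟨M', hM', -, -, hv⟩ := exists_isMatching_of_injective (doubleCover R hR)
    (fun x : {x // x ∉ E true} => (x.1, true)) (fun x => (f x, false))
    (fun x y hxy => Subtype.ext (congrArg Prod.fst hxy)) (fun x y hxy => hf (congrArg Prod.fst hxy))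
    (fun _ _ hxy => by simpa using congrArg Prod.snd hxy) (fun x => ⟨by simp, (hf' x).1⟩)
  have hsurj : ∀ y, y ∉ E false → ∃ x, f x = y := by
    have himg : Finset.univ.image f = (E false)ᶜ := by
      apply Finset.eq_of_subset_of_card_le
      · intro y hy
        obtain ⟨x, -, rfl⟩ := Finset.mem_image.1 hy
        simpa using (hf' x).2
      · rw [Finset.card_image_of_injective _ hf, Finset.card_compl, Finset.card_univ,
          Fintype.card_subtype_compl, Fintype.card_coe, hE, hE]
    intro y hy
    have : y ∈ Finset.univ.image f := by simpa [himg] using hy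
    simpa using this
  refine ⟨M ⊔ M', ⟨hM.sup hM' ?_, ?_⟩, le_sup_left⟩
  · rw [hM.support_eq_verts, hM'.support_eq_verts, hv, Set.disjoint_left]
    rintro p hp (⟨x, rfl⟩ | ⟨x, rfl⟩)
    · exact x.2 ((hmem _ _).2 hp)
    · exact (hf' x).2 ((hmem _ _).2 hp)
  · rintro ⟨x, b⟩
    rw [Subgraph.verts_sup, hv]
    by_cases hx : x ∈ E b
    · exact Or.inl ((hmem _ _).1 hx)
    · right
      cases b
      · obtain ⟨y, rfl⟩ := hsurj x hx
        exact Or.inr ⟨y, rfl⟩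
      · exact Or.inl ⟨⟨x, hx⟩, rfl⟩

end DoubleCover

/-! ### Edge counting in forests and the shape of small trees -/

section TreeFacts

variable {V : Type*} {T : SimpleGraph V} [DecidableRel T.Adj]

/-- A nonempty set of `s` vertices of a forest spans at most `s - 1` edges. -/
theorem sum_card_filter_adj_add_two_le (hT : T.IsAcyclic) {S : Finset V} (hS : S.Nonempty) :
    ∑ v ∈ S, (S.filter (T.Adj v)).card + 2 ≤ 2 * S.card := by
  classical
  have hne : Nonempty (S : Set V) := hS.to_subtype
  -- A forest on `S` extends to a spanning tree of the complete graph on `S`, which has `|S| - 1`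
  -- edges.
  obtain ⟨F, hle, -, hF⟩ := (connected_top (V := (S : Set V))).exists_isTree_le_of_le_of_isAcyclic
    (H := T.induce (S : Set V)) le_top (hT.induce _)
  have hcard := hF.card_edgeFinset
  have hmono : (T.induce (S : Set V)).edgeFinset.card ≤ F.edgeFinset.card :=
    Finset.card_le_card (edgeFinset_mono hle)
  have hsum := (T.induce (S : Set V)).sum_degrees_eq_twice_card_edges
  have hdeg : ∑ v, (T.induce (S : Set V)).degree v = ∑ v ∈ S, (S.filter (T.Adj v)).card := by
    rw [← Finset.sum_coe_sort S]
    refine Finset.sum_congr rfl fun v _ => ?_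
    rw [← card_neighborFinset_eq_degree, ← Finset.card_map (Function.Embedding.subtype _)]
    congr 1
    ext y
    simp
    tauto
  have hc : Fintype.card (S : Set V) = S.card := by simp
  rw [hc] at hcard
  omega

variable [Fintype V]

/-- Lower bound for the number of vertices that separate `Y` from the rest of a forest. -/
theorem two_mul_sum_degree_add_two_le (hT : T.IsAcyclic) {Y N : Finset V} (hY : Y.Nonempty)
    (hd : Disjoint Y N) (hN : ∀ y ∈ Y, ∀ x, T.Adj y x → x ∈ Y ∨ x ∈ N) :
    2 * ∑ y ∈ Y, T.degree y + 2 ≤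
      2 * (Y.card + N.card) + ∑ y ∈ Y, (Y.filter (T.Adj y)).card := by
  classical
  have h := sum_card_filter_adj_add_two_le hT (S := Y ∪ N) (hY.mono Finset.subset_union_left)
  rw [Finset.card_union_of_disjoint hd, Finset.sum_union hd] at h
  have h1 : ∀ y ∈ Y, T.degree y = ((Y ∪ N).filter (T.Adj y)).card := by
    intro y hy
    rw [← card_neighborFinset_eq_degree]
    congr 1
    ext x
    have := hN y hy x
    simp
    tauto
  have h2 : ∀ y ∈ Y, T.degree y = (Y.filter (T.Adj y)).card + (N.filter (T.Adj y)).card := by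
    intro y hy
    rw [h1 y hy, Finset.filter_union, Finset.card_union_of_disjoint]
    exact Finset.disjoint_filter_filter hd
  -- Edges inside `N` are dropped; those between `Y` and `N` are counted from both ends, whence the
  -- factor 2 on the degrees of `Y`.
  have h3 : ∑ x ∈ N, (Y.filter (T.Adj x)).card ≤ ∑ x ∈ N, ((Y ∪ N).filter (T.Adj x)).card :=
    Finset.sum_le_sum fun x _ =>
      Finset.card_le_card (Finset.filter_subset_filter _ Finset.subset_union_left)
  have h4 : ∑ x ∈ N, (Y.filter (T.Adj x)).card = ∑ y ∈ Y, (N.filter (T.Adj y)).card := by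
    simp only [Finset.card_filter]
    rw [Finset.sum_comm]
    simp only [T.adj_comm]
  have h5 := Finset.sum_congr rfl h1
  have h6 := Finset.sum_congr rfl h2
  rw [Finset.sum_add_distrib] at h6
  omega

theorem card_mul_le_sum_degree {Y : Finset V} {r : ℕ} (h : ∀ y ∈ Y, r ≤ T.degree y) :
    Y.card * r ≤ ∑ y ∈ Y, T.degree y := by
  simpa using Finset.card_nsmul_le_sum Y (fun y => T.degree y) r h

/-- An independent set of vertices of large degree in a forest has many neighbours. -/
theorem mul_card_lt_of_independent (hT : T.IsAcyclic) {k : ℕ} {Y N : Finset V} (hY : Y.Nonempty)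
    (hd : Disjoint Y N) (hN : ∀ y ∈ Y, ∀ x, T.Adj y x → x ∈ N)
    (hdeg : ∀ y ∈ Y, k + 1 ≤ T.degree y) : k * Y.card + 1 ≤ N.card := by
  have h := two_mul_sum_degree_add_two_le hT hY hd fun y hy x hx => Or.inr (hN y hy x hx)
  have h0 : ∑ y ∈ Y, (Y.filter (T.Adj y)).card = 0 := by
    refine Finset.sum_eq_zero fun y hy => ?_
    rw [Finset.card_eq_zero, Finset.filter_eq_empty_iff]
    exact fun x hx hxy => Finset.disjoint_left.1 hd hx (hN y hy x hxy)
  have h1 := card_mul_le_sum_degree hdeg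
  nlinarith

/-- A nonempty set of vertices of degree more than `k` in a forest has more than `k` outer
neighbours. -/
theorem lt_card_of_neighbors (hT : T.IsAcyclic) {k : ℕ} (hk : 1 ≤ k) {Y N : Finset V}
    (hY : Y.Nonempty) (hd : Disjoint Y N) (hN : ∀ y ∈ Y, ∀ x, T.Adj y x → x ∈ Y ∨ x ∈ N)
    (hdeg : ∀ y ∈ Y, k + 1 ≤ T.degree y) : k + 1 ≤ N.card := by
  have h := two_mul_sum_degree_add_two_le hT hY hd hN
  have h0 := sum_card_filter_adj_add_two_le hT hY
  have h1 := card_mul_le_sum_degree hdeg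
  have h2 := hY.card_pos
  -- The bounds combine to `(k - 1)|Y| + 2 ≤ |N|`, and `|Y| ≥ 1`.
  obtain ⟨j, rfl⟩ : ∃ j, k = j + 1 := ⟨k - 1, by omega⟩
  nlinarith

/-- A set of vertices of a connected graph that is closed under adjacency and nonempty is
everything. -/
theorem mem_of_adj_closed {W : Type*} {G : SimpleGraph W} (hG : G.Connected) {p : W → Prop}
    {a : W} (ha : p a) (h : ∀ x y, G.Adj x y → p x → p y) (b : W) : p b := by
  obtain ⟨w⟩ := hG.preconnected a b
  induction w with
  | nil => exact ha
  | cons hxy _ ih => exact ih (h _ _ hxy ha)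

theorem eq_of_adj_of_degree_eq_one {x y z : V} (hx : T.degree x = 1) (hy : T.Adj x y)
    (hz : T.Adj x z) : y = z :=
  (degree_eq_one_iff_existsUnique_adj.1 hx).unique hy hz

theorem nonempty_iso_top_of_adj_leaves (hT : T.Connected) {u v : V} (huv : T.Adj u v)
    (hu : T.degree u = 1) (hv : T.degree v = 1) :
    Nonempty (T ≃g completeGraph (Fin 2)) := by
  classical
  have hall : ∀ x, x = u ∨ x = v := by
    refine mem_of_adj_closed hT (a := u) (Or.inl rfl) ?_
    rintro x y hxy (rfl | rfl)
    · exact Or.inr (eq_of_adj_of_degree_eq_one hu hxy huv)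
    · exact Or.inl (eq_of_adj_of_degree_eq_one hv hxy huv.symm)
  have htop : T = completeGraph V := by
    ext x y
    rcases hall x with rfl | rfl <;> rcases hall y with rfl | rfl <;>
      simp [huv, huv.symm, huv.ne, huv.ne']
  have hcard : Fintype.card V = 2 := by
    rw [Fintype.card_eq_nat_card, ← Set.ncard_univ, ← Set.ncard_pair huv.ne]
    congr 1
    ext x
    simpa using hall x
  rw [htop]
  exact ⟨Iso.completeGraph (Fintype.equivFinOfCardEq hcard)⟩

/-- A graph in which every vertex other than `q` is a leaf adjacent to `q` is a star. -/
theorem isStar_of_center {q : V} (hq : ∀ x, x ≠ q → T.Adj q x) (hl : ∀ x, x ≠ q → T.degree x = 1)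
    (h2 : 2 ≤ T.degree q) : IsStar T (T.degree q) := by
  classical
  refine ⟨h2, ?_⟩
  have hcard : Fintype.card {x // ¬ x = q} = T.degree q := by
    rw [← card_neighborFinset_eq_degree, Fintype.card_subtype]
    congr 1
    ext x
    simp only [Finset.mem_filter, Finset.mem_univ, true_and, mem_neighborFinset]
    exact ⟨hq x, fun h => h.ne'⟩
  let e1 : {x // x = q} ≃ Fin 1 := Equiv.ofUnique _ _
  let e2 : {x // ¬ x = q} ≃ Fin (T.degree q) := Fintype.equivFinOfCardEq hcard
  let e : V ≃ Fin 1 ⊕ Fin (T.degree q) := (Equiv.sumCompl (· = q)).symm.trans (e1.sumCongr e2)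
  have hadj : ∀ x y, T.Adj x y ↔ (x = q ∧ y ≠ q) ∨ (x ≠ q ∧ y = q) := by
    intro x y
    by_cases hx : x = q <;> by_cases hy : y = q
    · simp [hx, hy]
    · simp [hx, hy, hq y hy]
    · simp [hx, hy, (hq x hx).symm]
    · simp only [hx, hy, false_and, and_false, or_self, iff_false]
      exact fun h => hy (eq_of_adj_of_degree_eq_one (hl x hx) h (hq x hx).symm)
  have hel : ∀ x, (e x).isLeft ↔ x = q := by
    intro x
    by_cases hx : x = q
    · simp [e, hx]
    · simp [e, hx, Equiv.sumCompl_symm_apply_of_neg]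
  refine ⟨⟨e, ?_⟩⟩
  intro x y
  rw [hadj, completeBipartiteGraph_adj, ← Sum.not_isLeft, ← Sum.not_isLeft]
  simp only [hel]

end TreeFacts

/-! ### Unrelated sets within one copy of the tree -/

section SingleCopy

variable {V : Type*} [Fintype V] [DecidableEq V] {T : SimpleGraph V} [DecidableRel T.Adj]

/-- The non-leaves outside both `A` and `B`. -/
def freeInner (T : SimpleGraph V) [DecidableRel T.Adj] (A B : Finset V) : Finset V :=
  Finset.univ.filter fun v => T.degree v ≠ 1 ∧ v ∉ A ∪ B

/-- The leaves outside both `A` and `B`. -/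
def freeLeaves (T : SimpleGraph V) [DecidableRel T.Adj] (A B : Finset V) : Finset V :=
  Finset.univ.filter fun v => T.degree v = 1 ∧ v ∉ A ∪ B

theorem card_freeInner_add_card_freeLeaves (A B : Finset V) :
    (freeInner T A B).card + (freeLeaves T A B).card = (A ∪ B)ᶜ.card := by
  rw [← Finset.card_union_of_disjoint]
  · congr 1
    ext v
    simp only [freeInner, freeLeaves, Finset.mem_union, Finset.mem_filter, Finset.mem_univ,
      true_and, Finset.mem_compl]
    tauto
  · rw [Finset.disjoint_left]
    intro v
    simp only [freeInner, freeLeaves, Finset.mem_filter]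
    tauto

variable {k : ℕ} {A B : Finset V}

/-- A neighbour of a common vertex lies in neither set, so `A ∩ B` is independent with all its
neighbours free. -/
theorem mul_card_inter_lt (hT : IsRTree T (k + 1)) (hAB : ∀ x ∈ A, ∀ y ∈ B, ¬ T.Adj x y)
    (hleaf : ∀ x ∈ A ∩ B, T.degree x ≠ 1) (hQ : (A ∩ B).Nonempty) :
    k * (A ∩ B).card + 1 ≤ (freeInner T A B).card + (freeLeaves T A B).card := by
  rw [card_freeInner_add_card_freeLeaves]
  refine mul_card_lt_of_independent hT.1.isAcyclic hQ ?_ ?_ fun y hy => hT.2 y (hleaf y hy)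
  · rw [Finset.disjoint_left]
    intro v
    simp
    tauto
  · intro y hy x hxy
    rw [Finset.mem_inter] at hy
    simp only [Finset.mem_compl, Finset.mem_union, not_or]
    exact ⟨fun hx => hAB x hx y hy.2 hxy.symm, fun hx => hAB y hy.1 x hx hxy⟩

theorem lt_card_freeInner_add_card_freeLeaves (hk : 1 ≤ k) (hT : IsRTree T (k + 1))
    (hAB : ∀ x ∈ A, ∀ y ∈ B, ¬ T.Adj x y) (hB : B.Nonempty) (hleaf : ∀ x ∈ B, T.degree x ≠ 1) :
    k + 1 ≤ (freeInner T A B).card + (freeLeaves T A B).card := by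
  rw [card_freeInner_add_card_freeLeaves]
  refine lt_card_of_neighbors hT.1.isAcyclic hk hB ?_ ?_ fun y hy => hT.2 y (hleaf y hy)
  · rw [Finset.disjoint_left]
    intro v
    simp
    tauto
  · intro y hy x hxy
    by_cases hx : x ∈ B
    · exact Or.inl hx
    · right
      simp only [Finset.mem_compl, Finset.mem_union, not_or]
      exact ⟨fun hx => hAB x hx y hy hxy.symm, hx⟩

theorem freeInner_nonempty (hT : T.IsTree) (hAB : ∀ x ∈ A, ∀ y ∈ B, ¬ T.Adj x y)
    (hA : A.Nonempty) (hB : B.Nonempty) (hQ : A ∩ B = ∅) : (freeInner T A B).Nonempty := by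
  by_contra hO
  rw [Finset.not_nonempty_iff_eq_empty] at hO
  obtain ⟨a, ha⟩ := hA
  obtain ⟨b, hb⟩ := hB
  have hdis : ∀ x ∈ A, x ∉ B := fun x hx hx' => by
    simpa [hQ] using Finset.mem_inter.2 ⟨hx, hx'⟩
  have hfree : ∀ x, x ∉ A → x ∉ B → T.degree x = 1 := by
    intro x hxA hxB
    by_contra h
    have : x ∈ freeInner T A B := by simp [freeInner, h, hxA, hxB]
    simp [hO] at this
  -- Spreading from `a`: if no non-leaf is free, every vertex outside `A` that is reached is a leaf
  -- whose only neighbour is in `A`, a dead end, so `B` is never reached.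
  have key : ∀ x, x ∉ B ∧ (x ∉ A → ∃ u ∈ A, T.Adj x u) := by
    refine mem_of_adj_closed hT.connected (a := a) ⟨hdis a ha, fun h => absurd ha h⟩ ?_
    rintro x y hxy ⟨hxB, hx⟩
    by_cases hxA : x ∈ A
    · exact ⟨fun hy => hAB x hxA y hy hxy, fun _ => ⟨x, hxA, hxy.symm⟩⟩
    · obtain ⟨u, hu, hxu⟩ := hx hxA
      obtain rfl := eq_of_adj_of_degree_eq_one (hfree x hxA hxB) hxy hxu
      exact ⟨hdis y hu, fun h => absurd hu h⟩
  exact (key b).1 hb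

/-- Scaled by `k` so that the sum over the `k` copies counts the shared free leaves exactly `k`
times. With a free non-leaf it follows from `mul_card_inter_lt`; without one, a common vertex forces
a star, whose centre must have at least `2 * k` leaves. -/
theorem mul_card_inter_add_one_le (hk : 1 ≤ k) (hT : IsRTree T (k + 1))
    (hstar : ¬ ∃ p : ℕ, p < 2 * k ∧ IsStar T p)
    (hAB : ∀ x ∈ A, ∀ y ∈ B, ¬ T.Adj x y) (hleaf : ∀ x ∈ A ∩ B, T.degree x ≠ 1)
    (hC : k ≤ (freeLeaves T A B).card) :
    k * ((A ∩ B).card + 1) ≤ (freeLeaves T A B).card + k * (freeInner T A B).card := by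
  rcases (A ∩ B).eq_empty_or_nonempty with hQ | hQ
  · rw [hQ]
    simp only [Finset.card_empty]
    nlinarith
  have h1 := mul_card_inter_lt hT hAB hleaf hQ
  rcases (freeInner T A B).eq_empty_or_nonempty with hO | hO
  · obtain ⟨q, hq⟩ := hQ
    have hq' := Finset.mem_inter.1 hq
    have hnb : ∀ x, T.Adj q x → x ∈ freeLeaves T A B := by
      intro x hx
      have hxAB : x ∉ A ∪ B := by
        simp only [Finset.mem_union, not_or]
        exact ⟨fun h => hAB x h q hq'.2 hx.symm, fun h => hAB q hq'.1 x h hx⟩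
      have hx1 : T.degree x = 1 := by
        by_contra h
        have : x ∈ freeInner T A B := by simpa [freeInner, h] using hxAB
        simp [hO] at this
      simp only [freeLeaves, Finset.mem_filter, Finset.mem_univ, true_and]
      exact ⟨hx1, hxAB⟩
    have hdeg1 : ∀ x, T.Adj q x → T.degree x = 1 := by
      intro x hx
      have := hnb x hx
      simp only [freeLeaves, Finset.mem_filter] at this
      exact this.2.1
    have hall : ∀ x, x = q ∨ T.Adj q x := by
      refine mem_of_adj_closed hT.1.connected (a := q) (Or.inl rfl) ?_
      rintro x y hxy (rfl | hx)
      · exact Or.inr hxy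
      · exact Or.inl (eq_of_adj_of_degree_eq_one (hdeg1 x hx) hxy hx.symm)
    have hqd : k + 1 ≤ T.degree q := hT.2 q (hleaf q hq)
    have hs : IsStar T (T.degree q) :=
      isStar_of_center (fun x hx => (hall x).resolve_left hx)
        (fun x hx => hdeg1 x ((hall x).resolve_left hx)) (by omega)
    have h2k : 2 * k ≤ T.degree q := by
      by_contra h
      exact hstar ⟨_, not_le.1 h, hs⟩
    have hQ1 : (A ∩ B).card ≤ 1 := by
      rw [← Finset.card_singleton q]
      refine Finset.card_le_card fun x hx => ?_
      rw [Finset.mem_singleton]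
      exact (hall x).resolve_right fun h => hleaf x hx (hdeg1 x h)
    have hle : T.degree q ≤ (freeLeaves T A B).card := by
      rw [← card_neighborFinset_eq_degree]
      exact Finset.card_le_card fun x hx => hnb x (by simpa using hx)
    nlinarith
  · have := hO.card_pos
    obtain ⟨j, rfl⟩ : ∃ j, k = j + 1 := ⟨k - 1, by omega⟩
    nlinarith

end SingleCopy

/-- A surplus in one copy suffices when no copy has a deficit. -/
theorem sum_add_le_sum_add {ι : Type*} [Fintype ι] {q o : ι → ℕ} {a b : ℕ}
    (h : ∀ i, q i ≤ o i) (i : ι) (hi : q i + a ≤ o i + b) : ∑ j, q j + a ≤ b + ∑ j, o j := by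
  classical
  rw [← Finset.add_sum_erase _ q (Finset.mem_univ i),
    ← Finset.add_sum_erase _ o (Finset.mem_univ i)]
  have := Finset.sum_le_sum (s := Finset.univ.erase i) fun j _ => h j
  omega

/-! ### The Hall-type bound in the glued graph -/

section Glued

variable {V : Type*} [Fintype V] {T : SimpleGraph V} [DecidableRel T.Adj] {k : ℕ}

theorem copyVertex_of_leaf {v : V} (h : T.degree v = 1) (i : Fin k) :
    copyVertex T k i v = Sum.inl ⟨v, h⟩ := dif_pos h

theorem copyVertex_of_inner {v : V} (h : T.degree v ≠ 1) (i : Fin k) :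
    copyVertex T k i v = Sum.inr (i, ⟨v, h⟩) := dif_neg h

theorem exists_copyVertex_eq (hk : 1 ≤ k) (x : GluedVertex T k) :
    ∃ i v, copyVertex T k i v = x := by
  rcases x with ⟨v, h⟩ | ⟨i, v, h⟩
  · exact ⟨⟨0, hk⟩, v, copyVertex_of_leaf h _⟩
  · exact ⟨i, v, copyVertex_of_inner h i⟩

/-- The adjacency relation of the glued graph, with a loop at each leaf. -/
def loopedAdj (T : SimpleGraph V) [DecidableRel T.Adj] (k : ℕ) (x y : GluedVertex T k) : Prop :=
  (gluedGraph T k).Adj x y ∨ (x = y ∧ x ∈ gluedLeaves T k)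

theorem loopedAdj_symm (x y : GluedVertex T k) (h : loopedAdj T k x y) : loopedAdj T k y x := by
  rcases h with h | ⟨rfl, h⟩
  · exact Or.inl h.symm
  · exact Or.inr ⟨rfl, h⟩

theorem loopedAdj_copyVertex {u v : V} (h : T.Adj u v) (i : Fin k) :
    loopedAdj T k (copyVertex T k i u) (copyVertex T k i v) := Or.inl ⟨i, u, v, h, rfl, rfl⟩

theorem loopedAdj_leaf {v : V} (h : T.degree v = 1) (i j : Fin k) :
    loopedAdj T k (copyVertex T k i v) (copyVertex T k j v) := by
  rw [copyVertex_of_leaf h, copyVertex_of_leaf h]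
  exact Or.inr ⟨rfl, ⟨_, rfl⟩⟩

variable [DecidableEq V]

/-- Leaves are shared, so they are counted in one reference copy `j`; non-leaves are counted copy by
copy. -/
theorem card_glued_finset (P : Finset (GluedVertex T k)) (j : Fin k) :
    P.card = (Finset.univ.filter fun v => T.degree v = 1 ∧ copyVertex T k j v ∈ P).card +
      ∑ i, (Finset.univ.filter fun v => T.degree v ≠ 1 ∧ copyVertex T k i v ∈ P).card := by
  rw [← Finset.card_toLeft_add_card_toRight]
  congr 1
  · rw [← Finset.card_map (Function.Embedding.subtype _)]
    congr 1
    ext v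
    simp only [Finset.mem_map, Finset.mem_toLeft, Function.Embedding.subtype_apply,
      Finset.mem_filter, Finset.mem_univ, true_and]
    constructor
    · rintro ⟨⟨a, ha⟩, h, rfl⟩
      exact ⟨ha, by rwa [copyVertex_of_leaf ha]⟩
    · rintro ⟨hv, h⟩
      exact ⟨⟨v, hv⟩, by rwa [copyVertex_of_leaf hv] at h, rfl⟩
  · rw [Finset.card_eq_sum_card_fiberwise (f := Prod.fst) (t := Finset.univ) (by simp)]
    refine Finset.sum_congr rfl fun i _ => ?_
    refine Finset.card_bij (fun x _ => x.2.1) ?_ ?_ ?_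
    · rintro ⟨j, v, hv⟩ h
      simp only [Finset.mem_filter, Finset.mem_toRight, Finset.mem_univ, true_and] at h ⊢
      obtain ⟨h, rfl⟩ := h
      exact ⟨hv, by rwa [copyVertex_of_inner hv]⟩
    · rintro ⟨j, v, hv⟩ h ⟨j', v', hv'⟩ h' heq
      simp only [Finset.mem_filter] at h h'
      obtain ⟨-, rfl⟩ := h
      obtain ⟨-, rfl⟩ := h'
      simpa using heq
    · intro v hv
      simp only [Finset.mem_filter, Finset.mem_univ, true_and] at hv
      refine ⟨(i, ⟨v, hv.1⟩), ?_, rfl⟩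
      simp only [Finset.mem_filter, Finset.mem_toRight, and_true]
      have := hv.2
      rwa [copyVertex_of_inner hv.1] at this

/-- Two nonempty sets of vertices of the glued graph with no adjacency between them leave out at
least `k` more vertices than they share. -/
theorem card_add_card_add_le (hk : 1 ≤ k) (hT : IsRTree T (k + 1))
    (hstar : ¬ ∃ p : ℕ, p < 2 * k ∧ IsStar T p) (A B : Finset (GluedVertex T k))
    (hA : A.Nonempty) (hB : B.Nonempty) (hAB : ∀ x ∈ A, ∀ y ∈ B, ¬ loopedAdj T k x y) :
    A.card + B.card + k ≤ Fintype.card (GluedVertex T k) := by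
  let z : Fin k := ⟨0, hk⟩
  let a : Fin k → Finset V := fun i => Finset.univ.filter fun v => copyVertex T k i v ∈ A
  let b : Fin k → Finset V := fun i => Finset.univ.filter fun v => copyVertex T k i v ∈ B
  have ha : ∀ i v, v ∈ a i ↔ copyVertex T k i v ∈ A := by simp [a]
  have hb : ∀ i v, v ∈ b i ↔ copyVertex T k i v ∈ B := by simp [b]
  have hab : ∀ i, ∀ x ∈ a i, ∀ y ∈ b i, ¬ T.Adj x y := fun i x hx y hy h =>
    hAB _ ((ha i x).1 hx) _ ((hb i y).1 hy) (loopedAdj_copyVertex h i)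
  have hleaf : ∀ i, ∀ x ∈ a i ∩ b i, T.degree x ≠ 1 := fun i x hx h => by
    rw [Finset.mem_inter] at hx
    exact hAB _ ((ha i x).1 hx.1) _ ((hb i x).1 hx.2) (loopedAdj_leaf h i i)
  let c := (freeLeaves T (a z) (b z)).card
  have hcopy : ∀ i j {v : V}, T.degree v = 1 → copyVertex T k i v = copyVertex T k j v :=
    fun i j v h => by rw [copyVertex_of_leaf h, copyVertex_of_leaf h]
  have hc : ∀ i, (freeLeaves T (a i) (b i)).card = c := by
    intro i
    simp only [c]
    congr 1
    ext v
    simp only [freeLeaves, Finset.mem_filter, Finset.mem_univ, true_and, Finset.mem_union, ha, hb]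
    refine and_congr_right fun h => ?_
    rw [hcopy i z h]
  have hinter : (A ∩ B).card = ∑ i, (a i ∩ b i).card := by
    rw [card_glued_finset _ z]
    have h0 : (Finset.univ.filter fun v => T.degree v = 1 ∧ copyVertex T k z v ∈ A ∩ B) = ∅ := by
      rw [Finset.filter_eq_empty_iff]
      rintro v - ⟨h, hv⟩
      refine hleaf z v ?_ h
      simpa [ha, hb] using hv
    rw [h0, Finset.card_empty, zero_add]
    refine Finset.sum_congr rfl fun i _ => ?_
    congr 1
    ext v
    have := hleaf i v
    simp only [Finset.mem_filter, Finset.mem_univ, true_and, Finset.mem_inter, ha, hb] at this ⊢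
    tauto
  have hcompl : (A ∪ B)ᶜ.card = c + ∑ i, (freeInner T (a i) (b i)).card := by
    rw [card_glued_finset _ z]
    simp only [c, freeLeaves, freeInner, Finset.mem_compl, Finset.mem_union, ha, hb]
  have key : ∑ i, (a i ∩ b i).card + k ≤ c + ∑ i, (freeInner T (a i) (b i)).card := by
    rcases le_or_gt k c with hkc | hkc
    · have h : ∀ i, k * ((a i ∩ b i).card + 1) ≤ c + k * (freeInner T (a i) (b i)).card := by
        intro i
        have := mul_card_inter_add_one_le hk hT hstar (hab i) (hleaf i) (by rwa [hc i])
        rwa [hc i] at this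
      have hs := Finset.sum_le_sum (s := Finset.univ) fun i _ => h i
      simp only [← Finset.mul_sum, Finset.sum_add_distrib, Finset.sum_const, Finset.card_univ,
        Fintype.card_fin, smul_eq_mul, mul_one] at hs
      rw [← mul_add] at hs
      exact Nat.le_of_mul_le_mul_left hs hk
    · have hpos : ∀ i, (a i ∩ b i).Nonempty →
          (a i ∩ b i).card + k ≤ (freeInner T (a i) (b i)).card + c := by
        intro i hi
        have h1 := mul_card_inter_lt hT (hab i) (hleaf i) hi
        rw [hc i] at h1
        have := hi.card_pos
        obtain ⟨j, rfl⟩ : ∃ j, k = j + 1 := ⟨k - 1, by omega⟩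
        -- Since `q ≥ 1`, `q + k ≤ k * q + 1`.
        nlinarith
      have hle : ∀ i, (a i ∩ b i).card ≤ (freeInner T (a i) (b i)).card := by
        intro i
        rcases (a i ∩ b i).eq_empty_or_nonempty with h | h
        · simp [h]
        · have := hpos i h
          omega
      by_cases hex : ∃ i, (a i ∩ b i).Nonempty
      · obtain ⟨i, hi⟩ := hex
        exact sum_add_le_sum_add hle i (hpos i hi)
      have hemp : ∀ i, a i ∩ b i = ∅ := fun i => by
        rw [← Finset.not_nonempty_iff_eq_empty]
        exact fun h => hex ⟨i, h⟩
      by_cases hlA : ∃ v ∈ a z, T.degree v = 1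
      · by_cases hlB : ∃ v ∈ b z, T.degree v = 1
        · obtain ⟨u, hu, hu1⟩ := hlA
          obtain ⟨v, hv, hv1⟩ := hlB
          -- Leaves belong to every copy, so both traces are nonempty in each of the `k` copies, and
          -- each copy has a free non-leaf.
          have h1 : ∀ i, (a i ∩ b i).card + 1 ≤ (freeInner T (a i) (b i)).card := by
            intro i
            rw [hemp i, Finset.card_empty]
            refine (freeInner_nonempty hT.1 (hab i) ⟨u, ?_⟩ ⟨v, ?_⟩ (hemp i)).card_pos
            · rw [ha, hcopy i z hu1, ← ha]
              exact hu
            · rw [hb, hcopy i z hv1, ← hb]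
              exact hv
          have hs := Finset.sum_le_sum (s := Finset.univ) fun i _ => h1 i
          simp only [Finset.sum_add_distrib, Finset.sum_const, Finset.card_univ,
            Fintype.card_fin, smul_eq_mul, mul_one] at hs
          omega
        · obtain ⟨y, hy⟩ := hB
          obtain ⟨i, v, rfl⟩ := exists_copyVertex_eq hk y
          have h2 := lt_card_freeInner_add_card_freeLeaves hk hT (hab i) ⟨v, (hb i v).2 hy⟩
            (fun x hx h => hlB ⟨x, by rw [hb, hcopy z i h, ← hb]; exact hx, h⟩)
          rw [hc i] at h2
          refine sum_add_le_sum_add hle i ?_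
          rw [hemp i, Finset.card_empty]
          omega
      · obtain ⟨y, hy⟩ := hA
        obtain ⟨i, v, rfl⟩ := exists_copyVertex_eq hk y
        have h2 := lt_card_freeInner_add_card_freeLeaves hk hT (A := b i) (B := a i)
          (fun x hx y hy h => hab i y hy x hx h.symm) ⟨v, (ha i v).2 hy⟩
          (fun x hx h => hlA ⟨x, by rw [ha, hcopy z i h, ← ha]; exact hx, h⟩)
        rw [card_freeInner_add_card_freeLeaves, Finset.union_comm,
          ← card_freeInner_add_card_freeLeaves (T := T), hc i] at h2
        refine sum_add_le_sum_add hle i ?_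
        rw [hemp i, Finset.card_empty]
        omega
  have h1 := Finset.card_union_add_card_inter A B
  have h2 := Finset.card_add_card_compl (A ∪ B)
  omega

end Glued

/-! ### Extendability and minimality of the double cover -/

/-- A matching with `k` edges that covers all neighbours of a vertex `z`, but not `z`, shows that
a graph is not `k`-extendable. -/
theorem not_isExtendable_of_isolating {W : Type*} {G : SimpleGraph W} {k : ℕ} {M : G.Subgraph}
    (hM : M.IsMatching) (hk : M.edgeSet.ncard = k) {z : W} (hz : z ∉ M.verts)
    (hcov : ∀ y, G.Adj z y → y ∈ M.verts) : ¬ IsExtendable G k := by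
  intro h
  obtain ⟨P, hP, hle⟩ := h.extends_to_perfect M hM hk
  obtain ⟨y, hzy⟩ := (hP.1 (hP.2 z)).exists
  obtain ⟨w, hyw⟩ := (hM (hcov y (P.adj_sub hzy))).exists
  have := hP.1.eq_of_adj_left hzy.symm (hle.2 hyw)
  exact hz (this ▸ M.edge_vert hyw.symm)

section LeafCover

variable {V : Type*} [Fintype V] {T : SimpleGraph V} [DecidableRel T.Adj] {k : ℕ}

/-- The bipartite double cover of the glued graph with a loop at each leaf. -/
def leafCover (T : SimpleGraph V) [DecidableRel T.Adj] (k : ℕ) :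
    SimpleGraph (GluedVertex T k × Bool) :=
  doubleCover (loopedAdj T k) loopedAdj_symm

/-- The vertex of `T` that a vertex of the glued graph comes from. -/
def gluedProj (x : GluedVertex T k) : V := Sum.elim Subtype.val (fun p => p.2.1) x

theorem gluedProj_copyVertex (i : Fin k) (v : V) : gluedProj (copyVertex T k i v) = v := by
  unfold copyVertex
  split_ifs <;> rfl

theorem eq_of_copyVertex_eq {i j : Fin k} {u v : V} (h : copyVertex T k i u = copyVertex T k j v) :
    u = v := by
  rw [← gluedProj_copyVertex (T := T) i u, h, gluedProj_copyVertex]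

theorem copyVertex_injective_index {v : V} (hv : T.degree v ≠ 1) :
    Function.Injective fun i : Fin k => copyVertex T k i v := by
  intro i j h
  simp only [copyVertex_of_inner hv] at h
  simpa using h

theorem loopedAdj_leaf_iff {l v : V} (hl : T.degree l = 1) (hlv : T.Adj l v)
    {y : GluedVertex T k} :
    loopedAdj T k (Sum.inl ⟨l, hl⟩) y ↔ y = Sum.inl ⟨l, hl⟩ ∨ ∃ j, y = copyVertex T k j v := by
  constructor
  · rintro (⟨i, a, b, hab, ha, rfl⟩ | ⟨rfl, -⟩)
    · rw [← copyVertex_of_leaf hl i] at ha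
      obtain rfl := eq_of_copyVertex_eq ha
      exact Or.inr ⟨i, by rw [eq_of_adj_of_degree_eq_one hl hab hlv]⟩
    · exact Or.inl rfl
  · rintro (rfl | ⟨j, rfl⟩)
    · exact Or.inr ⟨rfl, ⟨_, rfl⟩⟩
    · rw [← copyVertex_of_leaf hl j]
      exact loopedAdj_copyVertex hlv j

theorem loopedAdj_inner_iff {v : V} (hv : T.degree v ≠ 1) {i : Fin k} {y : GluedVertex T k} :
    loopedAdj T k (Sum.inr (i, ⟨v, hv⟩)) y ↔ ∃ u, T.Adj v u ∧ copyVertex T k i u = y := by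
  constructor
  · rintro (⟨j, a, b, hab, ha, rfl⟩ | ⟨-, ⟨_, h⟩⟩)
    · rw [← copyVertex_of_inner hv i] at ha
      obtain rfl := eq_of_copyVertex_eq ha
      obtain rfl := copyVertex_injective_index hv ha
      exact ⟨b, hab, rfl⟩
    · cases h
  · rintro ⟨u, huv, rfl⟩
    rw [← copyVertex_of_inner hv i]
    exact loopedAdj_copyVertex huv i

theorem exists_isMatching_of_colours {X : Type*} {G : SimpleGraph (X × Bool)} {f g : Fin k → X}
    (hf : Function.Injective f) (hg : Function.Injective g) (γ : Bool)
    (hadj : ∀ j, G.Adj (f j, γ) (g j, !γ)) :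
    ∃ M : G.Subgraph, M.IsMatching ∧ M.edgeSet.ncard = k ∧ (∀ j, M.Adj (f j, γ) (g j, !γ)) ∧
      M.verts = Set.range (fun j => (f j, γ)) ∪ Set.range (fun j => (g j, !γ)) := by
  have := exists_isMatching_of_injective G (fun j => (f j, γ)) (fun j => (g j, !γ))
    (fun i j h => hf (congrArg Prod.fst h)) (fun i j h => hg (congrArg Prod.fst h))
    (fun i j h => by simpa using congrArg Prod.snd h) hadj
  simpa using this

/-- The edges `f j`–`g j` use up every neighbour of `x` except `y`; deleting the edge to `y` leaves
`x` no partner. -/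
theorem not_isExtendable_delete_of_cover {X : Type*} {R : X → X → Prop}
    {hR : ∀ x y, R x y → R y x} {f g : Fin k → X}
    (hf : Function.Injective f) (hg : Function.Injective g) (hfg : ∀ j, R (f j) (g j)) {x y : X}
    (hx : ∀ j, f j ≠ x) (hcov : ∀ z, R x z → z = y ∨ ∃ j, g j = z) (γ : Bool) :
    ¬ IsExtendable ((doubleCover R hR).deleteEdges {s((x, γ), (y, !γ))}) k := by
  have hadj : ∀ j, ((doubleCover R hR).deleteEdges {s((x, γ), (y, !γ))}).Adj
      (f j, γ) (g j, !γ) := by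
    intro j
    rw [deleteEdges_adj]
    refine ⟨⟨by simp, hfg j⟩, ?_⟩
    simp [hx j]
  obtain ⟨M, hM, hc, -, hv⟩ := exists_isMatching_of_colours hf hg γ hadj
  refine not_isExtendable_of_isolating hM hc (z := (x, γ)) ?_ ?_
  · rw [hv]
    rintro (⟨j, h⟩ | ⟨j, h⟩)
    · exact hx j (congrArg Prod.fst h)
    · simpa using congrArg Prod.snd h
  · rintro ⟨z, δ⟩ h
    rw [deleteEdges_adj] at h
    obtain ⟨⟨hne, hxz⟩, he⟩ := h
    have hδ : δ = !γ := by cases γ <;> cases δ <;> simp_all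
    subst hδ
    rw [hv]
    rcases hcov z hxz with rfl | ⟨j, rfl⟩
    · simp at he
    · exact Or.inr ⟨j, rfl⟩

/-- Distinct neighbours, other than `l`, of a vertex `v` of degree more than `k`. -/
theorem exists_injective_neighbors {l v : V} (hv : k + 1 ≤ T.degree v) :
    ∃ σ : Fin k → V, Function.Injective σ ∧ ∀ j, T.Adj v (σ j) ∧ σ j ≠ l := by
  classical
  have hcard : Fintype.card (Fin k) ≤ Fintype.card ((T.neighborFinset v).erase l) := by
    rw [Fintype.card_coe, Fintype.card_fin]
    have := Finset.pred_card_le_card_erase (s := T.neighborFinset v) (a := l)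
    rw [card_neighborFinset_eq_degree] at this
    omega
  obtain ⟨e⟩ := Function.Embedding.nonempty_of_card_le hcard
  refine ⟨fun j => (e j).1, fun i j h => e.injective (Subtype.ext h), fun j => ?_⟩
  have := (e j).2
  rw [Finset.mem_erase, mem_neighborFinset] at this
  exact this.symm

theorem not_isExtendable_delete_loop {l v : V} (hl : T.degree l = 1) (hlv : T.Adj l v)
    (hv1 : T.degree v ≠ 1) (hv : k + 1 ≤ T.degree v) (γ : Bool) :
    ¬ IsExtendable ((leafCover T k).deleteEdges
      {s((Sum.inl ⟨l, hl⟩, γ), (Sum.inl ⟨l, hl⟩, !γ))}) k := by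
  -- The partners must come from distinct vertices of `T`: a leaf is the same vertex in every copy.
  obtain ⟨σ, hσ, hσv⟩ := exists_injective_neighbors (l := l) hv
  refine not_isExtendable_delete_of_cover (f := fun j => copyVertex T k j (σ j))
    (g := fun j => copyVertex T k j v) (fun i j h => hσ (eq_of_copyVertex_eq h))
    (copyVertex_injective_index hv1) (fun j => loopedAdj_copyVertex (hσv j).1.symm j) ?_ ?_ γ
  · intro j h
    rw [← copyVertex_of_leaf hl j] at h
    exact (hσv j).2 (eq_of_copyVertex_eq h)
  · intro z hz
    rcases (loopedAdj_leaf_iff hl hlv).1 hz with h | ⟨j, rfl⟩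
    · exact Or.inl h
    · exact Or.inr ⟨j, rfl⟩

theorem not_isExtendable_delete_leaf_edge {l v : V} (hl : T.degree l = 1) (hlv : T.Adj l v)
    (hv1 : T.degree v ≠ 1) (hv : k + 1 ≤ T.degree v) (i : Fin k) (γ : Bool) :
    ¬ IsExtendable ((leafCover T k).deleteEdges
      {s((copyVertex T k i l, γ), (copyVertex T k i v, !γ))}) k := by
  obtain ⟨σ, hσ, hσv⟩ := exists_injective_neighbors (l := l) hv
  -- The loop at `l` survives now, so the index `i`, freed by the deleted edge, is used to cover the
  -- opposite lift of `l` from copy `i` of `v`.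
  have hf : Function.Injective fun j => copyVertex T k j (if j = i then v else σ j) := by
    intro a b h
    have h' := eq_of_copyVertex_eq h
    have ha := (hσv a).1.ne
    have hb := (hσv b).1.ne
    have hab := @hσ a b
    grind
  have hg : Function.Injective fun j => copyVertex T k j (if j = i then l else v) := by
    intro a b h
    have h' := eq_of_copyVertex_eq h
    have hne := hlv.ne
    by_cases ha : a = i <;> by_cases hb : b = i
    · rw [ha, hb]
    · simp [ha, hb, hne] at h'
    · simp [ha, hb, hne.symm] at h'
    · simp only [ha, hb, if_false] at h
      exact copyVertex_injective_index hv1 h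
  refine not_isExtendable_delete_of_cover hf hg ?_ ?_ ?_ γ
  · intro j
    refine loopedAdj_copyVertex ?_ j
    split_ifs
    · exact hlv.symm
    · exact (hσv j).1.symm
  · intro j h
    have h' := eq_of_copyVertex_eq h
    split_ifs at h'
    · exact hlv.ne h'.symm
    · exact (hσv j).2 h'
  · intro z hz
    rw [copyVertex_of_leaf hl, loopedAdj_leaf_iff hl hlv] at hz
    rcases hz with rfl | ⟨j, rfl⟩
    · exact Or.inr ⟨i, by simp [copyVertex_of_leaf hl]⟩
    · by_cases hj : j = i
      · exact Or.inl (by rw [hj])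
      · exact Or.inr ⟨j, by simp [hj]⟩

theorem not_isExtendable_delete_inner_edge (hT : T.IsTree) {u v : V} (huv : T.Adj u v)
    (hu : T.degree u ≠ 1) (hv : T.degree v ≠ 1) (i : Fin k) (γ : Bool) :
    ¬ IsExtendable ((leafCover T k).deleteEdges
      {s((copyVertex T k i u, γ), (copyVertex T k i v, !γ))}) k := by
  classical
  intro hext
  have hadj : ∀ j, ((leafCover T k).deleteEdges
      {s((copyVertex T k i u, γ), (copyVertex T k i v, !γ))}).Adj
      (copyVertex T k j v, γ) (copyVertex T k j u, !γ) := by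
    intro j
    rw [deleteEdges_adj]
    refine ⟨⟨by simp, loopedAdj_copyVertex huv.symm j⟩, ?_⟩
    intro h
    rw [Set.mem_singleton_iff, Sym2.eq_iff] at h
    rcases h with h | h
    · exact huv.ne (eq_of_copyVertex_eq (congrArg Prod.fst h.1)).symm
    · simpa using congrArg Prod.snd h.1
  obtain ⟨M, hM, hc, hMadj, -⟩ := exists_isMatching_of_colours
    (copyVertex_injective_index hv) (copyVertex_injective_index hu) γ hadj
  obtain ⟨P, hP, hle⟩ := hext.extends_to_perfect M hM hc
  have hpart : ∀ x, ∃ y, P.Adj (x, γ) (y, !γ) := by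
    intro x
    obtain ⟨⟨y, δ⟩, hy⟩ := (hP.1 (hP.2 (x, γ))).exists
    have h := (deleteEdges_adj.1 (P.adj_sub hy)).1.1
    have hδ : δ = !γ := by cases γ <;> cases δ <;> simp_all
    exact ⟨y, hδ ▸ hy⟩
  choose π hπ using hpart
  have hπinj : Function.Injective π := by
    intro x y h
    have h1 := hπ x
    rw [h] at h1
    exact congrArg Prod.fst (hP.1.eq_of_adj_right h1 (hπ y))
  have hπv : ∀ j, π (copyVertex T k j v) = copyVertex T k j u := fun j =>
    congrArg Prod.fst (hP.1.eq_of_adj_left (hπ _) (hle.2 (hMadj j)))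
  -- `A` is the side of `u` when the bridge `uv` is removed. The permutation `π` given by `P` brings
  -- `k` vertices into the part `S` over `A`, so at least `k` must leave; they can leave only along
  -- copies of `uv`, and copy `i` is deleted in this direction.
  let A : Set V := {a | (T.deleteEdges {s(u, v)}).Reachable u a}
  have huA : u ∈ A := Reachable.refl _
  have hvA : v ∉ A := isAcyclic_iff_forall_adj_isBridge.1 hT.isAcyclic huv
  have hcross : ∀ a b, T.Adj a b → a ∈ A → b ∉ A → a = u ∧ b = v := by
    intro a b hab ha hb
    have hs : s(a, b) = s(u, v) := by
      by_contra hs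
      refine hb (Reachable.trans ha (Adj.reachable ?_))
      rw [deleteEdges_adj]
      exact ⟨hab, hs⟩
    rcases Sym2.eq_iff.1 hs with h | h
    · exact h
    · exact absurd (h.2 ▸ huA) hb
  let S : Finset (GluedVertex T k) := Finset.univ.filter fun x => gluedProj x ∈ A
  have hS : ∀ j a, copyVertex T k j a ∈ S ↔ a ∈ A := by
    intro j a
    simp [S, gluedProj_copyVertex]
  let N : Finset (GluedVertex T k) := Finset.univ.filter fun x => π x ∈ S
  have hN : N.card ≤ S.card := by
    refine Finset.card_le_card_of_injOn π (fun x hx => ?_) hπinj.injOn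
    simpa [N] using hx
  have h1 : k ≤ (N \ S).card := by
    have : (Finset.univ.image fun j : Fin k => copyVertex T k j v) ⊆ N \ S := by
      intro x hx
      obtain ⟨j, -, rfl⟩ := Finset.mem_image.1 hx
      rw [Finset.mem_sdiff, hS]
      refine ⟨?_, hvA⟩
      simp only [N, Finset.mem_filter, Finset.mem_univ, true_and, hπv, hS]
      exact huA
    have h := Finset.card_le_card this
    rwa [Finset.card_image_of_injective _ (copyVertex_injective_index hv), Finset.card_univ,
      Fintype.card_fin] at h
  have h2 : (S \ N).card < k := by
    have : S \ N ⊆ (Finset.univ.erase i).image fun j : Fin k => copyVertex T k j u := by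
      intro x hx
      rw [Finset.mem_sdiff] at hx
      obtain ⟨hxS, hxN⟩ := hx
      have hxN' : π x ∉ S := by simpa [N] using hxN
      obtain ⟨⟨-, hR⟩, he⟩ := deleteEdges_adj.1 (P.adj_sub (hπ x))
      rcases hR with ⟨j, a, b, hab, ha, hb⟩ | ⟨h, -⟩
      · dsimp only at ha hb
        rw [← ha, hS] at hxS
        rw [← hb, hS] at hxN'
        obtain ⟨rfl, rfl⟩ := hcross a b hab hxS hxN'
        refine Finset.mem_image.2 ⟨j, ?_, ha⟩
        rw [Finset.mem_erase]
        refine ⟨?_, Finset.mem_univ _⟩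
        rintro rfl
        rw [← ha] at he hb
        rw [← hb] at he
        exact he rfl
      · dsimp only at h
        exact absurd (h ▸ hxS) hxN'
    have h := (Finset.card_le_card this).trans Finset.card_image_le
    rw [Finset.card_erase_of_mem (Finset.mem_univ _), Finset.card_univ, Fintype.card_fin] at h
    have := i.2
    omega
  have h3 := Finset.card_sdiff_add_card_inter S N
  have h4 := Finset.card_sdiff_add_card_inter N S
  rw [Finset.inter_comm] at h4
  omega

theorem leafCover_minimal (hT : IsRTree T (k + 1))
    (hleaf : ∀ u v, T.Adj u v → T.degree u = 1 → T.degree v ≠ 1)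
    (e : Sym2 (GluedVertex T k × Bool)) (he : e ∈ (leafCover T k).edgeSet) :
    ¬ IsExtendable ((leafCover T k).deleteEdges {e}) k := by
  induction e with
  | _ p q =>
  obtain ⟨x, γ⟩ := p
  obtain ⟨y, δ⟩ := q
  obtain ⟨hne, hR⟩ := he
  obtain rfl : δ = !γ := by cases γ <;> cases δ <;> simp_all
  rcases hR with ⟨i, u, v, huv, hu, hv⟩ | ⟨hxy, ⟨⟨l, hl⟩, h⟩⟩
  · dsimp only at hu hv
    subst hu hv
    by_cases hu : T.degree u = 1
    · have hv := hleaf u v huv hu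
      exact not_isExtendable_delete_leaf_edge hu huv hv (hT.2 v hv) i γ
    by_cases hv : T.degree v = 1
    · have := not_isExtendable_delete_leaf_edge hv huv.symm hu (hT.2 u hu) i (!γ)
      rwa [Bool.not_not, Sym2.eq_swap] at this
    · exact not_isExtendable_delete_inner_edge hT.1 huv hu hv i γ
  · dsimp only at hxy h
    subst hxy h
    obtain ⟨v, hlv, -⟩ := degree_eq_one_iff_existsUnique_adj.1 hl
    have hv := hleaf l v hlv hl
    exact not_isExtendable_delete_loop hl hlv hv (hT.2 v hv) γ

/-- Walks of `T` lift to each copy, switching colour at each edge; the loop at `l` corrects the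
parity. -/
theorem leafCover_connected (hk : 1 ≤ k) (hT : T.IsTree) {l : V} (hl : T.degree l = 1) :
    (leafCover T k).Connected := by
  rw [connected_iff_exists_forall_reachable]
  refine ⟨(Sum.inl ⟨l, hl⟩, true), ?_⟩
  have key : ∀ v, ∀ i γ, (leafCover T k).Reachable (Sum.inl ⟨l, hl⟩, true)
      (copyVertex T k i v, γ) := by
    refine mem_of_adj_closed hT.connected (a := l) ?_ ?_
    · intro i γ
      rw [copyVertex_of_leaf hl]
      cases γ
      · exact Adj.reachable ⟨by simp, Or.inr ⟨rfl, ⟨_, rfl⟩⟩⟩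
      · exact Reachable.refl _
    · intro x y hxy h i γ
      exact (h i (!γ)).trans (Adj.reachable ⟨by simp, loopedAdj_copyVertex hxy i⟩)
  rintro ⟨x, γ⟩
  obtain ⟨i, v, rfl⟩ := exists_copyVertex_eq hk x
  exact key v i γ

theorem leafCover_isExtendable (hk : 1 ≤ k) (hT : IsRTree T (k + 1))
    (hstar : ¬ ∃ p : ℕ, p < 2 * k ∧ IsStar T p)
    (hL : k + 1 ≤ Fintype.card {v : V // T.degree v = 1}) :
    IsExtendable (leafCover T k) k := by
  classical
  obtain ⟨⟨l, hl⟩⟩ : Nonempty {v : V // T.degree v = 1} := Fintype.card_pos_iff.1 (by omega)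
  refine ⟨leafCover_connected hk hT.1 hl, ?_, ?_, ?_⟩
  · rw [Nat.card_eq_fintype_card, Fintype.card_prod, Fintype.card_sum, Fintype.card_bool]
    omega
  · obtain ⟨e⟩ := Function.Embedding.nonempty_of_card_le
      (α := Fin k) (β := {v : V // T.degree v = 1}) (by rw [Fintype.card_fin]; omega)
    obtain ⟨M, hM, hc, -⟩ := exists_isMatching_of_colours (G := leafCover T k) (f := fun j => Sum.inl (e j))
      (g := fun j => Sum.inl (e j)) (Sum.inl_injective.comp e.injective)
      (Sum.inl_injective.comp e.injective) true
      (fun j => ⟨by simp, Or.inr ⟨rfl, ⟨_, rfl⟩⟩⟩)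
    exact ⟨M, hM, hc⟩
  · exact exists_isPerfectMatching_of_independent_bound k (card_add_card_add_le hk hT hstar)

theorem leafCover_isMinimalBipartiteExtendable (hk : 1 ≤ k) (hT : IsRTree T (k + 1))
    (hleaf : ∀ u v, T.Adj u v → T.degree u = 1 → T.degree v ≠ 1)
    (hstar : ¬ ∃ p : ℕ, p < 2 * k ∧ IsStar T p)
    (hL : k + 1 ≤ Fintype.card {v : V // T.degree v = 1}) :
    IsMinimalBipartiteExtendable (leafCover T k) k :=
  ⟨doubleCover_isBipartite, leafCover_isExtendable hk hT hstar hL, leafCover_minimal hT hleaf⟩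

end LeafCover

/-! ### Invariance under isomorphism -/

section Transport

variable {W W' : Type*} {G : SimpleGraph W} {G' : SimpleGraph W'} {k : ℕ}

theorem ncard_edgeSet_map_iso (f : G ≃g G') (M : G.Subgraph) :
    (M.map f.toHom).edgeSet.ncard = M.edgeSet.ncard := by
  rw [Subgraph.edgeSet_map]
  exact Set.ncard_image_of_injective _ (Sym2.map.injective f.injective)

theorem IsExtendable.of_iso (h : IsExtendable G k) (f : G ≃g G') : IsExtendable G' k := by
  refine ⟨f.connected_iff.1 h.connected, ?_, ?_, ?_⟩
  · rw [← Nat.card_congr f.toEquiv]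
    exact h.order
  · obtain ⟨M, hM, hc⟩ := h.exists_matching
    exact ⟨M.map f.toHom, hM.map _ f.injective, by rw [ncard_edgeSet_map_iso, hc]⟩
  · intro M hM hc
    obtain ⟨P, hP, hle⟩ := h.extends_to_perfect (M.map f.symm.toHom) (hM.map _ f.symm.injective)
      (by rw [ncard_edgeSet_map_iso, hc])
    have hspan : ∀ x, x ∈ (P.map f.toHom).verts := fun x =>
      ⟨f.symm x, hP.2 _, f.apply_symm_apply x⟩
    refine ⟨P.map f.toHom, ⟨hP.1.map _ f.injective, hspan⟩, fun x _ => hspan x, ?_⟩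
    intro x y hxy
    exact ⟨f.symm x, f.symm y, hle.2 ⟨x, y, hxy, rfl, rfl⟩, f.apply_symm_apply x,
      f.apply_symm_apply y⟩

/-- Deleting corresponding edges from isomorphic graphs gives isomorphic graphs. -/
def deleteEdgeIso (f : G ≃g G') (e : Sym2 W) :
    G.deleteEdges {e} ≃g G'.deleteEdges {e.map f} where
  toEquiv := f.toEquiv
  map_rel_iff' := by
    intro x y
    have h : s(f x, f y) = e.map f ↔ s(x, y) = e := by
      rw [← Sym2.map_mk]
      exact (Sym2.map.injective f.injective).eq_iff
    change (G'.deleteEdges {e.map f}).Adj (f x) (f y) ↔ _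
    rw [deleteEdges_adj, deleteEdges_adj, Set.mem_singleton_iff, Set.mem_singleton_iff, h,
      f.map_adj_iff]

theorem IsMinimalBipartiteExtendable.of_iso (h : IsMinimalBipartiteExtendable G k)
    (f : G' ≃g G) : IsMinimalBipartiteExtendable G' k := by
  refine ⟨h.bipartite.of_hom f.toHom, h.extendable.of_iso f.symm, ?_⟩
  intro e he hext
  refine h.minimal (e.map f) ?_ (hext.of_iso (deleteEdgeIso f e))
  induction e with
  | _ x y => exact f.map_adj_iff.2 he

end Transport

/-! ### Identification with the double cover, and counting -/

section Count

variable {V : Type*} {T : SimpleGraph V} {k : ℕ}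

theorem exists_bool_colouring (hT : T.IsTree) :
    ∃ χ : V → Bool, ∀ u v, T.Adj u v → χ u ≠ χ v := by
  obtain ⟨c⟩ := hT.isBipartite
  refine ⟨fun v => decide (c v = 0), fun u v h => ?_⟩
  have := c.valid h
  have hu : c u = 0 ∨ c u = 1 := by omega
  have hv : c v = 0 ∨ c v = 1 := by omega
  rcases hu with hu | hu <;> rcases hv with hv | hv <;> simp_all

variable [Fintype V] [DecidableRel T.Adj]

/-- Two copies of the glued graph joined along their leaves form the double cover of the glued
graph with loops at the leaves. -/
theorem nonempty_joinAlong_iso_leafCover (hT : T.IsTree) (H' : SimpleGraph (GluedVertex T k))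
    (φ : gluedGraph T k ≃g H') :
    Nonempty (joinAlong (gluedGraph T k) (gluedLeaves T k) H' φ ≃g leafCover T k) := by
  obtain ⟨χ, hχ⟩ := exists_bool_colouring hT
  let ψ : GluedVertex T k → Bool := fun x => χ (gluedProj x)
  have hψ : ∀ x y, (gluedGraph T k).Adj x y → ψ x ≠ ψ y := by
    rintro x y ⟨i, u, v, huv, rfl, rfl⟩
    simp only [ψ, gluedProj_copyVertex]
    exact hχ u v huv
  -- A vertex of `H` goes to the sheet given by its colour, and its image in `H'` to the opposite
  -- sheet.
  let E : GluedVertex T k ⊕ GluedVertex T k ≃ GluedVertex T k × Bool :=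
    { toFun := Sum.elim (fun x => (x, ψ x)) fun y => (φ.symm y, !ψ (φ.symm y))
      invFun := fun p => if p.2 = ψ p.1 then Sum.inl p.1 else Sum.inr (φ p.1)
      left_inv := by
        rintro (x | y) <;> simp
      right_inv := by
        rintro ⟨x, b⟩
        by_cases h : b = ψ x
        · simp [h]
        · simp only [h, if_false, Sum.elim_inr, RelIso.symm_apply_apply, Prod.mk.injEq, true_and]
          revert h
          cases b <;> cases hx : ψ x <;> simp }
  refine ⟨⟨E, ?_⟩⟩
  rintro (x | x) (y | y)
  · have := hψ x y
    simp [E, joinAlong, leafCover, doubleCover, loopedAdj]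
    grind
  · simp [E, joinAlong, leafCover, doubleCover, loopedAdj]
    have := hψ x (φ.symm y)
    grind [RelIso.apply_symm_apply, RelIso.symm_apply_apply]
  · simp [E, joinAlong, leafCover, doubleCover, loopedAdj]
    have := hψ (φ.symm x) y
    grind [RelIso.apply_symm_apply, RelIso.symm_apply_apply]
  · simp [E, joinAlong, leafCover, doubleCover, loopedAdj]
    have := hψ (φ.symm x) (φ.symm y)
    have h2 : (gluedGraph T k).Adj (φ.symm x) (φ.symm y) ↔ H'.Adj x y := φ.symm.map_adj_iff
    grind

theorem exists_inner_vertex (hT : T.IsTree)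
    (hleaf : ∀ u v, T.Adj u v → T.degree u = 1 → T.degree v ≠ 1) : ∃ v, T.degree v ≠ 1 := by
  obtain ⟨v⟩ := hT.connected.nonempty
  by_cases hv : T.degree v = 1
  · obtain ⟨u, hu, -⟩ := degree_eq_one_iff_existsUnique_adj.1 hv
    exact ⟨u, hleaf v u hu hv⟩
  · exact ⟨v, hv⟩

/-- All outer neighbours of the nonempty set of non-leaves are leaves. -/
theorem lt_card_leaves (hk : 1 ≤ k) (hT : IsRTree T (k + 1))
    (hleaf : ∀ u v, T.Adj u v → T.degree u = 1 → T.degree v ≠ 1) :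
    k + 1 ≤ Fintype.card {v : V // T.degree v = 1} := by
  rw [Fintype.card_subtype]
  obtain ⟨v, hv⟩ := exists_inner_vertex hT.1 hleaf
  refine lt_card_of_neighbors hT.1.isAcyclic hk (Y := Finset.univ.filter fun v => T.degree v ≠ 1)
    ⟨v, by simpa using hv⟩ ?_ ?_ ?_
  · rw [Finset.disjoint_left]
    simp
  · intro y _ x _
    simp
    tauto
  · intro y hy
    exact hT.2 y (by simpa using hy)

theorem leafCover_degree_leaf [(leafCover T k).LocallyFinite]
    (hleaf : ∀ u v, T.Adj u v → T.degree u = 1 → T.degree v ≠ 1)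
    (l : {v : V // T.degree v = 1}) (γ : Bool) :
    (leafCover T k).degree (Sum.inl l, γ) = k + 1 := by
  classical
  obtain ⟨l, hl⟩ := l
  obtain ⟨v, hlv, -⟩ := degree_eq_one_iff_existsUnique_adj.1 hl
  have hv := hleaf l v hlv hl
  have : (leafCover T k).neighborFinset (Sum.inl ⟨l, hl⟩, γ) =
      insert (Sum.inl ⟨l, hl⟩, !γ)
        (Finset.univ.image fun j : Fin k => (copyVertex T k j v, !γ)) := by
    ext ⟨y, δ⟩
    rw [mem_neighborFinset]
    change (γ ≠ δ ∧ loopedAdj T k (Sum.inl ⟨l, hl⟩) y) ↔ _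
    rw [loopedAdj_leaf_iff hl hlv]
    simp only [Finset.mem_insert, Finset.mem_image, Finset.mem_univ, true_and, Prod.mk.injEq]
    have hδ : γ ≠ δ ↔ (!γ) = δ := by cases γ <;> cases δ <;> simp
    rw [hδ]
    grind
  rw [← card_neighborFinset_eq_degree, this, Finset.card_insert_of_notMem,
    Finset.card_image_of_injective, Finset.card_univ, Fintype.card_fin]
  · intro i j h
    exact copyVertex_injective_index hv (congrArg Prod.fst h)
  · simp [copyVertex_of_inner hv]

theorem leafCover_degree_inner [(leafCover T k).LocallyFinite] (i : Fin k)
    (v : {v : V // T.degree v ≠ 1}) (γ : Bool) :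
    (leafCover T k).degree (Sum.inr (i, v), γ) = T.degree v.1 := by
  classical
  obtain ⟨v, hv⟩ := v
  have : (leafCover T k).neighborFinset (Sum.inr (i, ⟨v, hv⟩), γ) =
      (T.neighborFinset v).image fun u => (copyVertex T k i u, !γ) := by
    ext ⟨y, δ⟩
    rw [mem_neighborFinset]
    change (γ ≠ δ ∧ loopedAdj T k (Sum.inr (i, ⟨v, hv⟩)) y) ↔ _
    rw [loopedAdj_inner_iff hv]
    simp only [Finset.mem_image, mem_neighborFinset, Prod.mk.injEq]
    have hδ : γ ≠ δ ↔ (!γ) = δ := by cases γ <;> cases δ <;> simp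
    rw [hδ]
    grind
  rw [← card_neighborFinset_eq_degree, this, Finset.card_image_of_injective,
    card_neighborFinset_eq_degree]
  intro a b h
  exact eq_of_copyVertex_eq (congrArg Prod.fst h)

theorem card_leaves_add_card_inner :
    Fintype.card {v : V // T.degree v = 1} + Fintype.card {v : V // T.degree v ≠ 1} =
      Fintype.card V := by
  rw [Fintype.card_subtype_compl]
  have := Fintype.card_subtype_le fun v : V => T.degree v = 1
  omega

/-- The handshake lemma for `|V| - 1` edges, each leaf contributing 1. -/
theorem card_leaves_add_sum_degree_inner (hT : T.IsTree) :
    Fintype.card {v : V // T.degree v = 1} + ∑ v : {v : V // T.degree v ≠ 1}, T.degree v.1 + 2 =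
      2 * (Fintype.card {v : V // T.degree v = 1} + Fintype.card {v : V // T.degree v ≠ 1}) := by
  classical
  rw [card_leaves_add_card_inner, ← hT.card_edgeFinset, mul_add,
    ← T.sum_degrees_eq_twice_card_edges,
    ← Fintype.sum_subtype_add_sum_subtype (fun v => T.degree v = 1) fun v => T.degree v]
  have : ∑ v : {v : V // T.degree v = 1}, T.degree v.1 =
      Fintype.card {v : V // T.degree v = 1} := by
    rw [Finset.sum_congr rfl fun v _ => v.2]
    simp
  rw [this]

theorem card_leafCover_vertices :
    Fintype.card (GluedVertex T k × Bool) =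
      2 * (Fintype.card {v : V // T.degree v = 1} +
        k * Fintype.card {v : V // T.degree v ≠ 1}) := by
  rw [Fintype.card_prod, Fintype.card_sum, Fintype.card_prod, Fintype.card_bool, Fintype.card_fin,
    mul_comm]

/-- Half the degree sum, with the inner degrees eliminated by the handshake identity of `T`. -/
theorem card_edgeFinset_leafCover [DecidableRel (leafCover T k).Adj] (hT : T.IsTree)
    (hleaf : ∀ u v, T.Adj u v → T.degree u = 1 → T.degree v ≠ 1) :
    (leafCover T k).edgeFinset.card + 2 * k =
      (2 * k + 1) * Fintype.card {v : V // T.degree v = 1} +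
        2 * k * Fintype.card {v : V // T.degree v ≠ 1} := by
  classical
  have h := (leafCover T k).sum_degrees_eq_twice_card_edges
  rw [Fintype.sum_prod_type, Fintype.sum_sum_type, Fintype.sum_prod_type] at h
  simp only [leafCover_degree_leaf hleaf, leafCover_degree_inner, Finset.sum_const,
    Finset.card_univ, Fintype.card_bool, Fintype.card_fin, smul_eq_mul, ← Finset.mul_sum] at h
  have h2 := card_leaves_add_sum_degree_inner hT
  generalize ∑ v : {v : V // T.degree v ≠ 1}, T.degree v.1 = s at h h2
  nlinarith

theorem card_filter_degree_leafCover [DecidableRel (leafCover T k).Adj]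
    (hT : IsRTree T (k + 2))
    (hleaf : ∀ u v, T.Adj u v → T.degree u = 1 → T.degree v ≠ 1) :
    (Finset.univ.filter fun x => (leafCover T k).degree x = k + 1).card =
      2 * Fintype.card {v : V // T.degree v = 1} := by
  classical
  have : (Finset.univ.filter fun x => (leafCover T k).degree x = k + 1) =
      Finset.univ.image fun p : {v : V // T.degree v = 1} × Bool => (Sum.inl p.1, p.2) := by
    ext ⟨x, γ⟩
    simp only [Finset.mem_filter, Finset.mem_univ, true_and, Finset.mem_image]
    rcases x with l | ⟨i, v⟩
    · simp [leafCover_degree_leaf hleaf]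
    · have := hT.2 v.1 v.2
      simp [leafCover_degree_inner]
      omega
  rw [this, Finset.card_image_of_injective, Finset.card_univ, Fintype.card_prod,
    Fintype.card_bool, mul_comm]
  rintro ⟨a, b⟩ ⟨c, d⟩ h
  simpa using h

theorem card_inner_of_isStar {p : ℕ} (h : IsStar T p) :
    Fintype.card {v : V // T.degree v ≠ 1} = 1 := by
  obtain ⟨hp, ⟨f⟩⟩ := h
  rw [Fintype.card_eq_one_iff]
  refine ⟨⟨f.symm (Sum.inl 0), ?_⟩, ?_⟩
  · intro h
    have hadj : ∀ j, T.Adj (f.symm (Sum.inl 0)) (f.symm (Sum.inr j)) := by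
      intro j
      rw [f.symm.map_adj_iff]
      simp
    have := eq_of_adj_of_degree_eq_one h (hadj ⟨0, by omega⟩) (hadj ⟨1, by omega⟩)
    simp at this
  · rintro ⟨v, hv⟩
    rw [Subtype.mk.injEq]
    rcases hfv : f v with a | b
    · rw [← Subsingleton.elim a 0, ← hfv, f.symm_apply_apply]
    · exfalso
      apply hv
      rw [degree_eq_one_iff_existsUnique_adj]
      refine ⟨f.symm (Sum.inl 0), ?_, ?_⟩
      · change T.Adj v _
        rw [← f.map_adj_iff, hfv, f.apply_symm_apply]
        simp
      · intro y hy
        rw [← f.map_adj_iff, hfv] at hy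
        rcases hfy : f y with a | c
        · rw [← Subsingleton.elim a 0, ← hfy, f.symm_apply_apply]
        · rw [hfy] at hy
          simp at hy

end Count

end KLeafMatching

/-! ### The main theorem -/

theorem mainTheorem10 (k : ℕ) (hk : 1 ≤ k)
    {V : Type*} [Fintype V] (T : SimpleGraph V) [DecidableRel T.Adj]
    (hT : KLeafMatching.IsRTree T (k + 1))
    (hK2 : ¬ Nonempty (T ≃g SimpleGraph.completeGraph (Fin 2)))
    (hstar : ¬ ∃ p : ℕ, p < 2 * k ∧ KLeafMatching.IsStar T p)
    {W : Type*} [Fintype W] [DecidableEq W] (G : SimpleGraph W) [DecidableRel G.Adj]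
    (hG : KLeafMatching.IsIsomorphicLeafMatching T k G) :
    KLeafMatching.IsMinimalBipartiteExtendable G k ∧
    (KLeafMatching.IsRTree T (k + 2) →
      ((Finset.univ.filter fun v : W => G.degree v = k + 1).card : ℚ) =
        2 * ((G.edgeFinset.card : ℚ) - (Fintype.card W : ℚ) + 2 * (k : ℚ)) / (2 * (k : ℚ) - 1) ∧
      (KLeafMatching.IsRegularRTree T (k + 2) →
        ((Finset.univ.filter fun v : W => G.degree v = k + 1).card : ℚ) =
          (Fintype.card W : ℚ) / 2 + 2) ∧
      ((∃ p : ℕ, KLeafMatching.IsStar T p) →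
        (G.edgeFinset.card : ℚ) =
          (2 * (k : ℚ) + 1) * ((Fintype.card W : ℚ) - 2 * (k : ℚ)) / 2)) := by
  classical
  obtain ⟨H', φ, ⟨g⟩⟩ := hG
  obtain ⟨g'⟩ := KLeafMatching.nonempty_joinAlong_iso_leafCover hT.1 H' φ
  let f : G ≃g KLeafMatching.leafCover T k := g.trans g'
  have hleaf : ∀ u v, T.Adj u v → T.degree u = 1 → T.degree v ≠ 1 := fun u v huv hu hv =>
    hK2 (KLeafMatching.nonempty_iso_top_of_adj_leaves hT.1.connected huv hu hv)
  refine ⟨(KLeafMatching.leafCover_isMinimalBipartiteExtendable hk hT hleaf hstar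
    (KLeafMatching.lt_card_leaves hk hT hleaf)).of_iso f, fun hT2 => ?_⟩
  have hn : Fintype.card W = _ := f.card_eq.trans KLeafMatching.card_leafCover_vertices
  have hm := KLeafMatching.card_edgeFinset_leafCover (k := k) hT.1 hleaf
  rw [← f.card_edgeFinset_eq] at hm
  have hd : (Finset.univ.filter fun v : W => G.degree v = k + 1).card =
      2 * Fintype.card {v : V // T.degree v = 1} := by
    rw [← KLeafMatching.card_filter_degree_leafCover hT2 hleaf]
    refine Finset.card_equiv f.toEquiv fun v => ?_
    simp only [Finset.mem_filter, Finset.mem_univ, true_and]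
    rw [← f.degree_eq v]
    rfl
  have hsum := KLeafMatching.card_leaves_add_sum_degree_inner hT.1
  rw [hd, hn]
  have hmQ := congrArg (Nat.cast (R := ℚ)) hm
  push_cast at hmQ ⊢
  have hkQ : (1 : ℚ) ≤ k := by exact_mod_cast hk
  refine ⟨?_, ?_, ?_⟩
  -- With `ℓ` leaves, `m - n + 2k = (2k - 1)ℓ`, and `|V_{k+1}| = 2ℓ`.
  · rw [eq_div_iff (by linarith)]
    linear_combination (-2) * hmQ
  · intro hreg
    have hs : ∑ v : {v : V // T.degree v ≠ 1}, T.degree v.1 =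
        Fintype.card {v : V // T.degree v ≠ 1} * (k + 2) := by
      rw [Finset.sum_congr rfl fun v _ => hreg.2 v.1 v.2]
      simp
    rw [hs] at hsum
    have hsQ := congrArg (Nat.cast (R := ℚ)) hsum
    push_cast at hsQ
    -- With `s` non-leaves, regularity gives `k s = ℓ - 2`.
    linear_combination (-1) * hsQ
  · rintro ⟨p, hp⟩
    rw [KLeafMatching.card_inner_of_isStar hp] at hmQ ⊢
    push_cast at hmQ ⊢
    linear_combination hmQ
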